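/- Let $n,m\ge 0$ be integers and $T>0$. Let $g:\mathbb{R}^n\to\mathbb{R}^{n\times m}$ and $h:\mathbb{R}^n\to\mathbb{R}^m$ be smooth ($C^\infty$), and let $f:[0,T]\times\mathbb{R}^n\to\mathbb{R}^n$ be such that (ii) there is $L\ge 0$ with $\|f(t,x_1)-f(t,x_2)\|\le L\|x_1-x_2\|$ for all $t\in[0,T]$ and $x_1,x_2\in\mathbb{R}^n$; (iii) for every $x\in\mathbb{R}^n$ the map $t\mapsto f(t,x)$ is absolutely continuous on $[0,T]$, and for every $R\ge 0$ $$\Phi(R)=\sup\Big\{\big\|\tfrac{\partial f}{\partial t}(\cdot,v(\cdot))\big\|_{L^2((0,T);\mathbb{R}^n)} \;:\; v\in L^2((0,T);\mathbb{R}^n),\ \|v\|_{L^2((0,T);\mathbb{R}^n)}\le R\Big\}<+\infty ,$$ where $\frac{\partial f}{\partial t}(t,x)$ is the classical partial derivative, set to $0$ at points where it does not exist. Let $\operatorname{sgn}$ be the multivalued sign, $\operatorname{sgn}(y)=\{1\}$ for $y>0$, $\operatorname{sgn}(y)=\{-1\}$ for $y<0$, $\operatorname{sgn}(0)=[-1,1]$,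 and for $y\in\mathbb{R}^m$ let $\operatorname{Sgn}(y)=\operatorname{sgn}(y_1)\times\dots\times\operatorname{sgn}(y_m)$. Let $g_{\bullet i}$ denote the $i$-th column of $g$. Suppose that for each $1\le i\le m$ the multivalued mapping $F_i:x\mapsto g_{\bullet i}(x)\operatorname{sgn}(h_i(x))$ is hypomonotone, i.e. there is $k_i\ge 0$ such that $F_i+k_i I$ is monotone: $\langle (x'+k_i x)-(y'+k_i y),\,x-y\rangle\ge 0$ for all $x,y\in\mathbb{R}^n$, $x'\in F_i(x)$, $y'\in F_i(y)$. Then for every $x_0\in\mathbb{R}^n$ the differential inclusion $$\dot x(t)\in f(t,x(t))-g(x(t))\operatorname{Sgn}(h(x(t)))\quad\text{for a.e. }t\in(0,T),\qquad x(0)=x_0,$$ has exactly one absolutely continuous solution $x:[0,T]\to\mathbb{R}^n$, and this solution is Lipschitz continuous on $[0,T]$. -/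

import Mathlib

open MeasureTheory Set
open scoped ContDiff NNReal ENNReal Matrix

/-- The multivalued sign on `ℝ`: `{1}` for `y > 0`, `{-1}` for `y < 0`, and `[-1, 1]` for `y = 0`. -/
def sgn (y : ℝ) : Set ℝ :=
  {s | (0 < y → s = 1) ∧ (y < 0 → s = -1) ∧ (y = 0 → s ∈ Icc (-1 : ℝ) 1)}

/-- The componentwise multivalued sign `Sgn y = sgn y₁ × ⋯ × sgn yₘ`. -/
def Sgn {m : ℕ} (y : Fin m → ℝ) : Set (Fin m → ℝ) :=
  {s | ∀ i, s i ∈ sgn (y i)}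

/-- The `i`-th column of a matrix, as a vector of Euclidean space. -/
def colVec {n m : ℕ} (G : Matrix (Fin n) (Fin m) ℝ) (i : Fin m) : EuclideanSpace ℝ (Fin n) :=
  WithLp.toLp 2 (fun j => G j i)

/-- The multivalued map `x ↦ g_{•i}(x) sgn(h_i(x))`. -/
def columnSign {n m : ℕ} (g : EuclideanSpace ℝ (Fin n) → Matrix (Fin n) (Fin m) ℝ)
    (h : EuclideanSpace ℝ (Fin n) → Fin m → ℝ) (i : Fin m) (x : EuclideanSpace ℝ (Fin n)) :
    Set (EuclideanSpace ℝ (Fin n)) :=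
  {z | ∃ s ∈ sgn (h x i), z = s • colVec (g x) i}

/-- The multivalued map `F` is monotone. -/
def IsMonotoneMap {n : ℕ}
    (F : EuclideanSpace ℝ (Fin n) → Set (EuclideanSpace ℝ (Fin n))) : Prop :=
  ∀ x y, ∀ x' ∈ F x, ∀ y' ∈ F y, 0 ≤ inner ℝ (x' - y') (x - y)

/-- The multivalued map `F` is hypomonotone: `F + k I` is monotone for some `k ≥ 0`. -/
def IsHypomonotone {n : ℕ}
    (F : EuclideanSpace ℝ (Fin n) → Set (EuclideanSpace ℝ (Fin n))) : Prop :=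
  ∃ k : ℝ, 0 ≤ k ∧ IsMonotoneMap (fun x => {z | ∃ w ∈ F x, z = w + k • x})

/-- The `L²((0,T); ℝⁿ)` norm, with values in `[0, ∞]`. -/
noncomputable def normL2 {n : ℕ} (T : ℝ) (v : ℝ → EuclideanSpace ℝ (Fin n)) : ℝ≥0∞ :=
  eLpNorm v 2 (volume.restrict (Ioo 0 T))

/-- `Φ(R)`: the supremum of the `L²((0,T))` norms of `t ↦ (∂f/∂t)(t, v(t))` over all
`v ∈ L²((0,T); ℝⁿ)` of norm at most `R`. -/
noncomputable def timeDerivBound {n : ℕ} (T : ℝ)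
    (f : ℝ → EuclideanSpace ℝ (Fin n) → EuclideanSpace ℝ (Fin n)) (R : ℝ≥0) : ℝ≥0∞ :=
  ⨆ (v : ℝ → EuclideanSpace ℝ (Fin n)) (_ : MemLp v 2 (volume.restrict (Ioo 0 T)))
    (_ : normL2 T v ≤ R), normL2 T (fun t => deriv (fun s => f s (v t)) t)

/-- `f` is Lipschitz in its second argument, uniformly for `t ∈ [0,T]`. -/
def LipschitzInState {n : ℕ} (T : ℝ)
    (f : ℝ → EuclideanSpace ℝ (Fin n) → EuclideanSpace ℝ (Fin n)) : Prop :=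
  ∃ L : ℝ, 0 ≤ L ∧ ∀ t ∈ Icc 0 T, ∀ x₁ x₂, ‖f t x₁ - f t x₂‖ ≤ L * ‖x₁ - x₂‖

/-- For every `x` the map `t ↦ f(t,x)` is absolutely continuous on `[0,T]` (so that `∂f/∂t(t,x)`
exists for almost every `t` and is also the weak derivative), and `Φ(R) < ∞` for all `R ≥ 0`. -/
def TimeDerivBoundedL2 {n : ℕ} (T : ℝ)
    (f : ℝ → EuclideanSpace ℝ (Fin n) → EuclideanSpace ℝ (Fin n)) : Prop :=
  (∀ x, AbsolutelyContinuousOnInterval (fun t => f t x) 0 T) ∧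
    ∀ R : ℝ≥0, timeDerivBound T f R < ⊤

/-- The right-hand side `f(t,x) - g(x) Sgn(h(x))`, a subset of `ℝⁿ`. -/
def slidingRHS {n m : ℕ} (f : ℝ → EuclideanSpace ℝ (Fin n) → EuclideanSpace ℝ (Fin n))
    (g : EuclideanSpace ℝ (Fin n) → Matrix (Fin n) (Fin m) ℝ)
    (h : EuclideanSpace ℝ (Fin n) → Fin m → ℝ) (t : ℝ) (x : EuclideanSpace ℝ (Fin n)) :
    Set (EuclideanSpace ℝ (Fin n)) :=
  {z | ∃ s ∈ Sgn (h x), z = f t x - WithLp.toLp 2 (g x *ᵥ s)}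

/-- `x` solves `x' ∈ f(t,x) - g(x) Sgn(h(x))` a.e. on `(0,T)` with `x(0) = x₀`: it is absolutely
continuous on `[0,T]` and satisfies the inclusion almost everywhere. -/
def IsSolution {n m : ℕ} (T : ℝ) (f : ℝ → EuclideanSpace ℝ (Fin n) → EuclideanSpace ℝ (Fin n))
    (g : EuclideanSpace ℝ (Fin n) → Matrix (Fin n) (Fin m) ℝ)
    (h : EuclideanSpace ℝ (Fin n) → Fin m → ℝ) (x₀ : EuclideanSpace ℝ (Fin n))
    (x : ℝ → EuclideanSpace ℝ (Fin n)) : Prop :=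
  AbsolutelyContinuousOnInterval x 0 T ∧ x 0 = x₀ ∧
    ∀ᵐ t ∂(volume.restrict (Ioo 0 T)),
      ∃ x' ∈ slidingRHS f g h t (x t), HasDerivAt x x' t

/-! The right-hand side is one-sided Lipschitz: for `z`, `z'` in its values at `(t, x)`, `(t, y)`,
one has `⟪z - z', x - y⟫ ≤ K ‖x - y‖²` with `K = L + ∑ kᵢ` (`exists_inner_slidingRHS_le`).
Uniqueness follows at once by Grönwall applied to the squared distance of two solutions.

For existence, take the single-valued selection `u(t, x) = f(t, x) - g(x) sign(h(x))`, which may be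
discontinuous in `x`, and its explicit Euler polygons. The one-sided bound keeps them in a fixed
ball (`norm_eulerSeq_sub_le`), so their velocities are bounded. The same bound, applied at the
frozen states of two polygons, makes fine polygons uniformly close
(`exists_norm_sub_le_of_isApproxSolution`); this needs uniform continuity of `u` in time but no
continuity in the state. The uniform limit is therefore Lipschitz and differentiable a.e.

Where it is differentiable, its derivative is a limit of averages of polygon velocities. By upper
semicontinuity of `sgn` these velocities lie near the set `f - g Sgn(h)` at the limit point, and
this set is closed and convex, so it contains the derivative (`deriv_mem_of_limit`). -/

/-! ### Euler polygons for a one-sided Lipschitz, possibly discontinuous field. -/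

section EulerScheme

variable {E : Type*} [NormedAddCommGroup E] [InnerProductSpace ℝ E]

/-- The explicit Euler iterates with step `η` for `x' = u(t, x)`, `x(0) = x₀`. -/
noncomputable def eulerSeq (u : ℝ → E → E) (η : ℝ) (x₀ : E) : ℕ → E
  | 0 => x₀
  | k + 1 => eulerSeq u η x₀ k + η • u (k * η) (eulerSeq u η x₀ k)

/-- `u` is one-sided Lipschitz in the state with constant `K`, uniformly for `t ∈ [0,T]`. -/
def OneSidedLipschitz (T K : ℝ) (u : ℝ → E → E) : Prop :=
  ∀ t ∈ Icc 0 T, ∀ x y, inner ℝ (u t x - u t y) (x - y) ≤ K * ‖x - y‖ ^ 2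

/-- One Euler step increases the squared distance to the initial point in a controlled way. -/
lemma sq_norm_euler_step_le {T K M₀ M η t : ℝ} {u : ℝ → E → E} {x₀ x : E}
    (hu : OneSidedLipschitz T K u) (ht : t ∈ Icc 0 T) (hη : 0 ≤ η) (h₀ : ‖u t x₀‖ ≤ M₀)
    (hM : ‖u t x‖ ≤ M) (hηM : η * M ^ 2 ≤ 1) :
    ‖x + η • u t x - x₀‖ ^ 2 ≤
      (1 + η * (2 * (K + 1))) * ‖x - x₀‖ ^ 2 + η * (2 * M₀ ^ 2 + 1) := by
  have h1 := hu t ht x x₀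
  have h2 : inner ℝ (u t x₀) (x - x₀) ≤ M₀ * ‖x - x₀‖ :=
    (real_inner_le_norm _ _).trans (by gcongr)
  rw [inner_sub_left] at h1
  -- Young's inequality absorbs `M₀ ‖x - x₀‖`, turning `K` into `K + 1`.
  have h3 : inner ℝ (x - x₀) (u t x) ≤ (K + 1) * ‖x - x₀‖ ^ 2 + M₀ ^ 2 := by
    rw [real_inner_comm]
    nlinarith [sq_nonneg (M₀ - ‖x - x₀‖), sq_nonneg M₀, sq_nonneg ‖x - x₀‖]
  have h4 : x + η • u t x - x₀ = (x - x₀) + η • u t x := by abel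
  rw [h4, norm_add_sq_real, inner_smul_right, norm_smul, Real.norm_of_nonneg hη, mul_pow]
  have h5 : ‖u t x‖ ^ 2 ≤ M ^ 2 := by gcongr
  -- The second-order term costs only `η` because `η M² ≤ 1`; this is the `+ 1` in `2 M₀² + 1`.
  have h6 : η ^ 2 * ‖u t x‖ ^ 2 ≤ η * 1 := by
    rw [sq, mul_assoc]
    exact mul_le_mul_of_nonneg_left ((mul_le_mul_of_nonneg_left h5 hη).trans hηM) hη
  nlinarith [mul_le_mul_of_nonneg_left h3 hη]

/-- A priori bound for the Euler iterates, for small enough steps. -/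
lemma norm_eulerSeq_sub_le {T K M₀ M R η : ℝ} {u : ℝ → E → E} {x₀ : E}
    (hK : 0 ≤ K) (hu : OneSidedLipschitz T K u) (hη : 0 ≤ η)
    (h₀ : ∀ t ∈ Icc 0 T, ‖u t x₀‖ ≤ M₀)
    (hR : 0 ≤ R) (hR2 : Real.exp (2 * (K + 1) * T) * (T * (2 * M₀ ^ 2 + 1)) ≤ R ^ 2)
    (hM : ∀ t ∈ Icc 0 T, ∀ x, ‖x - x₀‖ ≤ R → ‖u t x‖ ≤ M) (hηM : η * M ^ 2 ≤ 1)
    (k : ℕ) (hk : k * η ≤ T) : ‖eulerSeq u η x₀ k - x₀‖ ≤ R := by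
  -- The growth estimate and the ball bound are proved together: the velocity bound `M` for the next
  -- step holds only while the current iterate is in the ball.
  have key : ∀ k : ℕ, k * η ≤ T → ‖eulerSeq u η x₀ k - x₀‖ ^ 2 ≤
      (1 + η * (2 * (K + 1))) ^ k * (k * η * (2 * M₀ ^ 2 + 1)) ∧
      ‖eulerSeq u η x₀ k - x₀‖ ≤ R := by
    intro k
    have hA : 0 ≤ η * (2 * (K + 1)) := by positivity
    have aux : ∀ k : ℕ, k * η ≤ T → ‖eulerSeq u η x₀ k - x₀‖ ^ 2 ≤
        (1 + η * (2 * (K + 1))) ^ k * (k * η * (2 * M₀ ^ 2 + 1)) →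
        ‖eulerSeq u η x₀ k - x₀‖ ≤ R := by
      intro k hk h
      refine abs_le_of_sq_le_sq' (h.trans (le_trans ?_ hR2)) hR |>.2
      gcongr
      calc (1 + η * (2 * (K + 1))) ^ k ≤ (Real.exp (η * (2 * (K + 1)))) ^ k := by
            gcongr
            linarith [Real.add_one_le_exp (η * (2 * (K + 1)))]
        _ = Real.exp (k * (η * (2 * (K + 1)))) := (Real.exp_nat_mul _ _).symm
        _ ≤ _ := by
            rw [Real.exp_le_exp]
            nlinarith [mul_le_mul_of_nonneg_right hk (by positivity : 0 ≤ 2 * (K + 1))]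
    induction k with
    | zero => exact fun hk => ⟨by simp [eulerSeq], by simpa [eulerSeq] using hR⟩
    | succ k ih =>
      intro hk
      have hk' : (k : ℝ) * η ≤ T := by
        push_cast at hk
        linarith
      obtain ⟨ih1, ih2⟩ := ih hk'
      have ht : (k : ℝ) * η ∈ Icc 0 T := ⟨by positivity, hk'⟩
      have := sq_norm_euler_step_le hu ht hη (h₀ _ ht) (hM _ ht _ ih2) hηM
      have h7 : ‖eulerSeq u η x₀ (k + 1) - x₀‖ ^ 2 ≤
        (1 + η * (2 * (K + 1))) ^ (k + 1) * ((k + 1 : ℕ) * η * (2 * M₀ ^ 2 + 1)) := by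
        refine this.trans ?_
        have h8 : 1 ≤ (1 + η * (2 * (K + 1))) ^ (k + 1) := one_le_pow₀ (by linarith)
        have h9 : 0 ≤ η * (2 * M₀ ^ 2 + 1) := by positivity
        calc _ ≤ (1 + η * (2 * (K + 1))) *
                ((1 + η * (2 * (K + 1))) ^ k * (k * η * (2 * M₀ ^ 2 + 1))) +
                (1 + η * (2 * (K + 1))) ^ (k + 1) * (η * (2 * M₀ ^ 2 + 1)) := by
              exact add_le_add (mul_le_mul_of_nonneg_left ih1 (by positivity))
                (le_mul_of_one_le_left h9 h8)
          _ = _ := by push_cast; ring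
      exact ⟨h7, aux _ hk h7⟩
  exact (key k hk).2

/-- `x` is a primitive of `t ↦ u (τ t) (y t)` where `τ t` and `y t` are `δ`-close to `t` and `x t`,
and everything is bounded. -/
structure IsApproxSolution (u : ℝ → E → E) (T R M δ : ℝ) (x₀ : E) (x y : ℝ → E) (τ : ℝ → ℝ) :
    Prop where
  init : x 0 = x₀
  intervalIntegrable : IntervalIntegrable (fun t => u (τ t) (y t)) volume 0 T
  integral_eq : ∀ a ∈ Icc 0 T, ∀ b ∈ Icc 0 T, ∫ t in a..b, u (τ t) (y t) = x b - x a
  hasDerivWithinAt : ∀ t ∈ Ico 0 T, HasDerivWithinAt x (u (τ t) (y t)) (Ici t) t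
  time_mem : ∀ t ∈ Icc 0 T, τ t ∈ Icc 0 T
  time_close : ∀ t ∈ Icc 0 T, |τ t - t| ≤ δ
  state_close : ∀ t ∈ Icc 0 T, ‖x t - y t‖ ≤ δ
  norm_state_le : ∀ t ∈ Icc 0 T, ‖y t‖ ≤ R
  norm_deriv_le : ∀ t ∈ Icc 0 T, ‖u (τ t) (y t)‖ ≤ M

lemma floor_div_eqOn {η : ℝ} (hη : 0 < η) (k : ℕ) :
    EqOn (fun t : ℝ => ⌊t / η⌋₊) (fun _ => k) (Ico (k * η) ((k + 1) * η)) := by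
  intro t ht
  have h0 : 0 ≤ t := le_trans (by positivity) ht.1
  rw [Nat.floor_eq_iff (by positivity), le_div_iff₀ hη, div_lt_iff₀ hη]
  exact ht

lemma mem_Ico_floor_div {η t : ℝ} (hη : 0 < η) (ht : 0 ≤ t) :
    t ∈ Ico ((⌊t / η⌋₊ : ℝ) * η) ((⌊t / η⌋₊ + 1) * η) :=
  ⟨(le_div_iff₀ hη).1 (Nat.floor_le (by positivity)), (div_lt_iff₀ hη).1 (Nat.lt_floor_add_one _)⟩

/-- The velocity of a polygon factors through the discrete space `ℕ`, so it is measurable without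
any regularity of the field. -/
lemma intervalIntegrable_comp_floor {F : Type*} [NormedAddCommGroup F] (V : ℕ → F) {η : ℝ}
    (hη : 0 < η) (a b : ℝ) : IntervalIntegrable (fun t => V ⌊t / η⌋₊) volume a b := by
  have hm : StronglyMeasurable (fun t : ℝ => V ⌊t / η⌋₊) :=
    (StronglyMeasurable.of_discrete (f := V)).comp_measurable
      (Nat.measurable_floor.comp (measurable_id.div_const η))
  rw [intervalIntegrable_iff]
  refine Measure.integrableOn_of_bounded (M := ∑ k ∈ Finset.range (⌊max a b / η⌋₊ + 1), ‖V k‖)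
    (by simp) hm.aestronglyMeasurable ?_
  rw [ae_restrict_iff' measurableSet_uIoc]
  refine Filter.Eventually.of_forall fun t ht => ?_
  refine Finset.single_le_sum (f := fun k => ‖V k‖) (fun _ _ => norm_nonneg _) ?_
  rw [Finset.mem_range, Nat.lt_succ_iff]
  exact Nat.floor_mono (div_le_div_of_nonneg_right ht.2 hη.le)

lemma integral_comp_floor [CompleteSpace E] (V : ℕ → E) {η t : ℝ} (hη : 0 < η) (k : ℕ)
    (ht : t ∈ Icc (k * η) ((k + 1) * η)) :
    ∫ s in (k * η)..t, V ⌊s / η⌋₊ = (t - k * η) • V k := by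
  rw [← intervalIntegral.integral_const]
  refine intervalIntegral.integral_congr_Ioo_of_le ht.1 fun s hs => ?_
  exact congrArg V (floor_div_eqOn hη k ⟨hs.1.le, hs.2.trans_le ht.2⟩)

/-- Since `⌊t / η⌋₊` is right-continuous, the right derivative exists at the nodes too, as the
Dini-derivative form of Grönwall's inequality requires. -/
lemma hasDerivWithinAt_integral_comp_floor [CompleteSpace E] (V : ℕ → E) {η t : ℝ}
    (hη : 0 < η) (ht : 0 ≤ t) (x₀ : E) :
    HasDerivWithinAt (fun t => x₀ + ∫ s in (0 : ℝ)..t, V ⌊s / η⌋₊) (V ⌊t / η⌋₊) (Ici t) t := by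
  refine HasDerivWithinAt.const_add _ ?_
  refine intervalIntegral.integral_hasDerivWithinAt_right (t := Ioi t)
    (intervalIntegrable_comp_floor V hη _ _) ?_ ?_
  · have hm : StronglyMeasurable (fun t : ℝ => V ⌊t / η⌋₊) :=
      (StronglyMeasurable.of_discrete (f := V)).comp_measurable
        (Nat.measurable_floor.comp (measurable_id.div_const η))
    exact hm.stronglyMeasurableAtFilter
  · refine ContinuousWithinAt.congr_of_eventuallyEq (f := fun _ => V ⌊t / η⌋₊)
      continuousWithinAt_const ?_ rfl
    have hmem := mem_Ico_floor_div hη ht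
    filter_upwards [Ioo_mem_nhdsGT hmem.2] with s hs
    exact congrArg V (floor_div_eqOn hη ⌊t / η⌋₊ ⟨hmem.1.trans hs.1.le, hs.2⟩)

lemma primitive_comp_floor_eq_eulerSeq [CompleteSpace E] (u : ℝ → E → E) {η : ℝ}
    (hη : 0 < η) (x₀ : E) (k : ℕ) :
    x₀ + ∫ s in (0 : ℝ)..(k * η), u (⌊s / η⌋₊ * η) (eulerSeq u η x₀ ⌊s / η⌋₊) =
      eulerSeq u η x₀ k := by
  have hi := intervalIntegrable_comp_floor (fun j => u (j * η) (eulerSeq u η x₀ j)) hη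
  induction k with
  | zero => simp [eulerSeq]
  | succ k ih =>
    have := integral_comp_floor (fun j => u (j * η) (eulerSeq u η x₀ j)) hη (t := (k + 1) * η) k
      ⟨by gcongr; linarith, le_rfl⟩
    push_cast
    rw [← intervalIntegral.integral_add_adjacent_intervals (hi 0 (k * η)) (hi _ _), ← add_assoc, ih,
      this, eulerSeq]
    congr 2
    ring

/-- The Euler polygons are approximate solutions of any accuracy, with uniform bounds. -/
theorem exists_isApproxSolution [CompleteSpace E] {T K : ℝ} {u : ℝ → E → E} (hT : 0 < T) (hK : 0 ≤ K)
    (hu : OneSidedLipschitz T K u)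
    (hb : ∀ R, ∃ M, ∀ t ∈ Icc 0 T, ∀ x, ‖x‖ ≤ R → ‖u t x‖ ≤ M) (x₀ : E) :
    ∃ R M : ℝ, 0 ≤ R ∧ 0 ≤ M ∧ ∀ δ > 0, ∃ x y τ, IsApproxSolution u T R M δ x₀ x y τ := by
  obtain ⟨M₀, hM₀⟩ := hb ‖x₀‖
  -- The radius `√B` depends only on `K`, `T` and the bound `M₀`, which controls the field at `x₀`.
  -- The bound `M` is taken on the resulting ball and the step is chosen last, so there is no
  -- circularity.
  set B := Real.exp (2 * (K + 1) * T) * (T * (2 * M₀ ^ 2 + 1)) with hB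
  have hB0 : 0 ≤ B := by positivity
  obtain ⟨M, hM⟩ := hb (Real.sqrt B + ‖x₀‖)
  have hMx : ∀ t ∈ Icc 0 T, ∀ x, ‖x - x₀‖ ≤ Real.sqrt B → ‖u t x‖ ≤ M := fun t ht x hx =>
    hM t ht x (by linarith [norm_le_norm_sub_add x x₀])
  have hM0 : 0 ≤ M := (norm_nonneg _).trans (hMx 0 ⟨le_rfl, hT.le⟩ x₀ (by simp))
  refine ⟨Real.sqrt B + ‖x₀‖, M, by positivity, hM0, fun δ hδ => ?_⟩
  -- The first entry of the minimum gives `η M² ≤ 1`; the second makes both the time lag `η` and the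
  -- displacement `η M` at most `δ`.
  obtain ⟨N, hN⟩ := exists_nat_gt (T / (min (1 / (M ^ 2 + 1)) (δ / (M + 1))))
  have hmin : 0 < min (1 / (M ^ 2 + 1)) (δ / (M + 1)) := by positivity
  have hNpos : (0 : ℝ) < N := lt_trans (by positivity) hN
  set η := T / N with hη'
  have hη : 0 < η := by positivity
  have hηle : η ≤ min (1 / (M ^ 2 + 1)) (δ / (M + 1)) := by
    rw [hη', div_le_iff₀ hNpos]
    rw [div_lt_iff₀ hmin] at hN
    linarith
  have hηM : η * M ^ 2 ≤ 1 := by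
    have := (le_div_iff₀ (by positivity)).1 (hηle.trans (min_le_left _ _))
    nlinarith
  have hηδ : η * (M + 1) ≤ δ := (le_div_iff₀ (by positivity)).1 (hηle.trans (min_le_right _ _))
  have hηδ' : η ≤ δ := by nlinarith
  have hfl : ∀ t ∈ Icc 0 T, (⌊t / η⌋₊ : ℝ) * η ∈ Icc 0 T := fun t ht =>
    ⟨by positivity, (mem_Ico_floor_div hη ht.1).1.trans ht.2⟩
  have hy : ∀ t ∈ Icc 0 T, ‖eulerSeq u η x₀ ⌊t / η⌋₊ - x₀‖ ≤ Real.sqrt B := fun t ht =>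
    norm_eulerSeq_sub_le hK hu hη.le (fun t ht => hM₀ t ht x₀ le_rfl) (Real.sqrt_nonneg _)
      (by rw [Real.sq_sqrt hB0]) hMx hηM _ (hfl t ht).2
  have hi := intervalIntegrable_comp_floor (fun j => u (j * η) (eulerSeq u η x₀ j)) hη
  have hv : ∀ t ∈ Icc 0 T, ‖u (⌊t / η⌋₊ * η) (eulerSeq u η x₀ ⌊t / η⌋₊)‖ ≤ M := fun t ht =>
    hMx _ (hfl t ht) _ (hy t ht)
  refine ⟨fun t => x₀ + ∫ s in (0 : ℝ)..t, u (⌊s / η⌋₊ * η) (eulerSeq u η x₀ ⌊s / η⌋₊),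
    fun t => eulerSeq u η x₀ ⌊t / η⌋₊, fun t => ⌊t / η⌋₊ * η, ?_⟩
  constructor
  · simp
  · exact hi 0 T
  · intro a _ b _
    rw [add_sub_add_left_eq_sub]
    exact (intervalIntegral.integral_interval_sub_left (hi _ _) (hi _ _)).symm
  · intro t ht
    exact hasDerivWithinAt_integral_comp_floor (fun j => u (j * η) (eulerSeq u η x₀ j)) hη ht.1 x₀
  · exact hfl
  · intro t ht
    have := mem_Ico_floor_div hη ht.1
    rw [abs_le]
    constructor <;> linarith [this.1, this.2]
  · intro t ht
    have hm := mem_Ico_floor_div hη ht.1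
    rw [← intervalIntegral.integral_add_adjacent_intervals (hi 0 (⌊t / η⌋₊ * η)) (hi _ _),
      ← add_assoc, primitive_comp_floor_eq_eulerSeq u hη,
      integral_comp_floor (fun j => u (j * η) (eulerSeq u η x₀ j)) hη _ ⟨hm.1, hm.2.le⟩,
      add_sub_cancel_left, norm_smul, Real.norm_of_nonneg (sub_nonneg.2 hm.1)]
    calc _ ≤ η * M := mul_le_mul (by linarith [hm.2]) (hv t ht) (norm_nonneg _) hη.le
      _ ≤ δ := by nlinarith
  · intro t ht
    linarith [norm_le_norm_sub_add (eulerSeq u η x₀ ⌊t / η⌋₊) x₀, hy t ht]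
  · exact hv

end EulerScheme

/-! ### Convergence of approximate solutions and identification of the limit velocity. -/

section Limit

open Filter Topology

variable {E : Type*} [NormedAddCommGroup E] [InnerProductSpace ℝ E]

namespace IsApproxSolution

variable {u : ℝ → E → E} {T R M δ : ℝ} {x₀ : E} {x y : ℝ → E} {τ : ℝ → ℝ}

lemma mono {δ' : ℝ} (hx : IsApproxSolution u T R M δ x₀ x y τ) (h : δ ≤ δ') :
    IsApproxSolution u T R M δ' x₀ x y τ :=
  { hx with
    time_close := fun t ht => (hx.time_close t ht).trans h
    state_close := fun t ht => (hx.state_close t ht).trans h }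

lemma norm_sub_le (hx : IsApproxSolution u T R M δ x₀ x y τ) {a b : ℝ} (ha : a ∈ Icc 0 T)
    (hb : b ∈ Icc 0 T) : ‖x b - x a‖ ≤ M * |b - a| := by
  rw [← hx.integral_eq a ha b hb]
  exact intervalIntegral.norm_integral_le_of_norm_le_const fun t ht =>
    hx.norm_deriv_le t (uIcc_subset_Icc ha hb (uIoc_subset_uIcc ht))

lemma continuousOn (hx : IsApproxSolution u T R M δ x₀ x y τ) (hM : 0 ≤ M) :
    ContinuousOn x (Icc 0 T) := by
  refine (LipschitzOnWith.of_dist_le_mul (K := ⟨M, hM⟩) fun a ha b hb => ?_).continuousOn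
  rw [dist_eq_norm, Real.dist_eq]
  exact hx.norm_sub_le hb ha

variable {x' y' : ℝ → E} {τ' : ℝ → ℝ}

/-- The one-sided bound is used only at the frozen states `y`, `y'` and the common time `τ t`.
Changing the time to `τ' t` costs `2Rρ`, and replacing `y - y'` by `x - x'` costs `4Mδ`. The
remaining constants come from `‖y - y'‖² ≤ 2‖x - x'‖² + 8δ²`, and everything is then doubled. -/
lemma inner_deriv_sub_le {K ρ t : ℝ} (hK : 0 ≤ K) (hu : OneSidedLipschitz T K u)
    (hM : 0 ≤ M) (hρ : ∀ s ∈ Icc 0 T, ∀ t ∈ Icc 0 T, |s - t| ≤ 2 * δ →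
      ∀ x, ‖x‖ ≤ R → ‖u s x - u t x‖ ≤ ρ)
    (hx : IsApproxSolution u T R M δ x₀ x y τ) (hx' : IsApproxSolution u T R M δ x₀ x' y' τ')
    (ht : t ∈ Icc 0 T) :
    2 * inner ℝ (x t - x' t) (u (τ t) (y t) - u (τ' t) (y' t)) ≤
      4 * K * ‖x t - x' t‖ ^ 2 + (16 * K * δ ^ 2 + 4 * R * ρ + 8 * M * δ) := by
  have hτ : |τ t - τ' t| ≤ 2 * δ := by
    have h1 := abs_le.1 (hx.time_close t ht)
    have h2 := abs_le.1 (hx'.time_close t ht)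
    exact abs_le.2 ⟨by linarith, by linarith⟩
  have hδ : 0 ≤ δ := (norm_nonneg _).trans (hx.state_close t ht)
  have hρ' := hρ _ (hx.time_mem t ht) _ (hx'.time_mem t ht) hτ _ (hx'.norm_state_le t ht)
  have hdec : inner ℝ (x t - x' t) (u (τ t) (y t) - u (τ' t) (y' t)) =
      inner ℝ (u (τ t) (y t) - u (τ t) (y' t)) (y t - y' t) +
      inner ℝ (u (τ t) (y' t) - u (τ' t) (y' t)) (y t - y' t) +
      inner ℝ (u (τ t) (y t) - u (τ' t) (y' t)) ((x t - y t) - (x' t - y' t)) := by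
    rw [← inner_add_left, sub_add_sub_cancel, ← inner_add_right, real_inner_comm]
    congr 1
    abel
  have h1 := hu _ (hx.time_mem t ht) (y t) (y' t)
  have h2 : inner ℝ (u (τ t) (y' t) - u (τ' t) (y' t)) (y t - y' t) ≤ ρ * (R + R) :=
    (real_inner_le_norm _ _).trans (mul_le_mul hρ' ((_root_.norm_sub_le _ _).trans
      (add_le_add (hx.norm_state_le t ht) (hx'.norm_state_le t ht))) (norm_nonneg _)
      ((norm_nonneg _).trans hρ'))
  have h3 : inner ℝ (u (τ t) (y t) - u (τ' t) (y' t)) ((x t - y t) - (x' t - y' t)) ≤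
      (M + M) * (δ + δ) :=
    (real_inner_le_norm _ _).trans (mul_le_mul ((_root_.norm_sub_le _ _).trans
      (add_le_add (hx.norm_deriv_le t ht) (hx'.norm_deriv_le t ht)))
      ((_root_.norm_sub_le _ _).trans
      (add_le_add (hx.state_close t ht) (hx'.state_close t ht))) (norm_nonneg _) (by positivity))
  have h4 : ‖y t - y' t‖ ≤ ‖x t - x' t‖ + (δ + δ) := by
    have : y t - y' t = (x t - x' t) - ((x t - y t) - (x' t - y' t)) := by abel
    rw [this]
    refine (_root_.norm_sub_le _ _).trans (add_le_add le_rfl ?_)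
    exact (_root_.norm_sub_le _ _).trans (add_le_add (hx.state_close t ht) (hx'.state_close t ht))
  have h5 : ‖y t - y' t‖ ^ 2 ≤ 2 * ‖x t - x' t‖ ^ 2 + 8 * δ ^ 2 := by
    nlinarith [pow_le_pow_left₀ (norm_nonneg _) h4 2, sq_nonneg (‖x t - x' t‖ - 2 * δ)]
  have h6 := mul_le_mul_of_nonneg_left h5 hK
  rw [hdec]
  linarith

lemma sq_norm_sub_le_gronwallBound {K ρ : ℝ} (hK : 0 ≤ K) (hu : OneSidedLipschitz T K u)
    (hM : 0 ≤ M) (hρ : ∀ s ∈ Icc 0 T, ∀ t ∈ Icc 0 T, |s - t| ≤ 2 * δ →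
      ∀ x, ‖x‖ ≤ R → ‖u s x - u t x‖ ≤ ρ)
    (hx : IsApproxSolution u T R M δ x₀ x y τ) (hx' : IsApproxSolution u T R M δ x₀ x' y' τ')
    {t : ℝ} (ht : t ∈ Icc 0 T) :
    ‖x t - x' t‖ ^ 2 ≤ gronwallBound 0 (4 * K) (16 * K * δ ^ 2 + 4 * R * ρ + 8 * M * δ) t := by
  have := le_gronwallBound_of_liminf_deriv_right_le (a := 0) (b := T)
    (f := fun t => ‖x t - x' t‖ ^ 2)
    (f' := fun t => 2 * inner ℝ (x t - x' t) (u (τ t) (y t) - u (τ' t) (y' t)))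
    (δ := 0) (K := 4 * K) (ε := 16 * K * δ ^ 2 + 4 * R * ρ + 8 * M * δ)
    (((hx.continuousOn hM).sub (hx'.continuousOn hM)).norm.pow 2) ?_
    (by simp [hx.init, hx'.init])
    (fun t ht => inner_deriv_sub_le hK hu hM hρ hx hx' (Ico_subset_Icc_self ht)) t ht
  · simpa using this
  · intro t ht r hr
    exact (((hx.hasDerivWithinAt t ht).sub (hx'.hasDerivWithinAt t ht)).norm_sq).liminf_right_slope_le hr

end IsApproxSolution

/-- Approximate solutions of high accuracy are uniformly close to each other. -/
theorem exists_norm_sub_le_of_isApproxSolution {T K R M : ℝ} {u : ℝ → E → E}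
    (hK : 0 ≤ K) (hu : OneSidedLipschitz T K u) (hR : 0 ≤ R) (hM : 0 ≤ M)
    (huc : ∀ ρ > 0, ∃ δ > 0, ∀ s ∈ Icc 0 T, ∀ t ∈ Icc 0 T, |s - t| ≤ δ →
      ∀ x, ‖x‖ ≤ R → ‖u s x - u t x‖ ≤ ρ) (x₀ : E) {ε : ℝ} (hε : 0 < ε) :
    ∃ δ > 0, ∀ x y τ x' y' τ', IsApproxSolution u T R M δ x₀ x y τ →
      IsApproxSolution u T R M δ x₀ x' y' τ' → ∀ t ∈ Icc 0 T, ‖x t - x' t‖ ≤ ε := by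
  -- With equal initial points the Grönwall bound vanishes at zero error and is continuous in the
  -- error.
  have hlim : ∀ᶠ e in 𝓝 (0 : ℝ), gronwallBound 0 (4 * K) e T < ε ^ 2 := by
    refine (gronwallBound_continuous_ε 0 (4 * K) T).continuousAt.eventually_lt_const ?_
    simp only [gronwallBound_ε0_δ0]
    positivity
  obtain ⟨e, he, hlim⟩ := Metric.eventually_nhds_iff.1 hlim
  -- A single `ρ` bounds both the accuracy and the oscillation in time. The accuracy is also kept
  -- below `δ / 2` because the two frozen times may differ by twice the accuracy.
  have hlim2 : ∀ᶠ ρ in 𝓝[>] (0 : ℝ), 16 * K * ρ ^ 2 + 4 * R * ρ + 8 * M * ρ < e := by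
    refine nhdsWithin_le_nhds (ContinuousAt.eventually_lt (by fun_prop) continuousAt_const ?_)
    simpa using he
  obtain ⟨ρ, hρ, hρ0⟩ := (hlim2.and self_mem_nhdsWithin).exists
  replace hρ0 : 0 < ρ := hρ0
  obtain ⟨δ, hδ, huδ⟩ := huc ρ hρ0
  have hmin : 0 < min ρ (δ / 2) := by positivity
  refine ⟨min ρ (δ / 2), hmin, fun x y τ x' y' τ' hx hx' t ht => ?_⟩
  have h1 := IsApproxSolution.sq_norm_sub_le_gronwallBound hK hu hM (ρ := ρ)
    (fun s hs t ht hst => huδ s hs t ht (hst.trans (by linarith [min_le_right ρ (δ / 2)])))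
    hx hx' ht
  have h2 : 16 * K * min ρ (δ / 2) ^ 2 + 4 * R * ρ + 8 * M * min ρ (δ / 2) < e := by
    refine lt_of_le_of_lt ?_ hρ
    have := min_le_left ρ (δ / 2)
    gcongr
  have h3 : 0 ≤ 16 * K * min ρ (δ / 2) ^ 2 + 4 * R * ρ + 8 * M * min ρ (δ / 2) := by positivity
  refine abs_le_of_sq_le_sq' (h1.trans ((gronwallBound_mono le_rfl h3 (by positivity) ht.2).trans
    (hlim ?_).le)) hε.le |>.2
  rwa [Real.dist_eq, sub_zero, abs_of_nonneg h3]

/-- The approximate solutions have a uniform limit. -/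
theorem exists_limit_of_isApproxSolution [CompleteSpace E] {T K R M : ℝ} {u : ℝ → E → E}
    (hK : 0 ≤ K) (hu : OneSidedLipschitz T K u) (hR : 0 ≤ R) (hM : 0 ≤ M)
    (huc : ∀ ρ > 0, ∃ δ > 0, ∀ s ∈ Icc 0 T, ∀ t ∈ Icc 0 T, |s - t| ≤ δ →
      ∀ x, ‖x‖ ≤ R → ‖u s x - u t x‖ ≤ ρ) (x₀ : E)
    (hex : ∀ δ > 0, ∃ x y τ, IsApproxSolution u T R M δ x₀ x y τ) :
    ∃ x : ℝ → E, ∀ ε > 0, ∃ x' y τ, IsApproxSolution u T R M ε x₀ x' y τ ∧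
      ∀ t ∈ Icc 0 T, ‖x' t - x t‖ ≤ ε := by
  have hpos : ∀ k : ℕ, (0 : ℝ) < 1 / (k + 1) := fun k => by positivity
  choose X Y S hXYS using fun k : ℕ => hex (1 / (k + 1)) (hpos k)
  have hsmall : ∀ δ > 0, ∃ N : ℕ, ∀ k ≥ N, IsApproxSolution u T R M δ x₀ (X k) (Y k) (S k) := by
    intro δ hδ
    obtain ⟨N, hN⟩ := exists_nat_one_div_lt hδ
    exact ⟨N, fun k hk => (hXYS k).mono ((one_div_le_one_div_of_le (by positivity)
      (by gcongr)).trans hN.le)⟩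
  have hcau : ∀ ε > 0, ∃ N : ℕ, ∀ k ≥ N, ∀ l ≥ N, ∀ t ∈ Icc 0 T, ‖X k t - X l t‖ ≤ ε := by
    intro ε hε
    obtain ⟨δ, hδ, h⟩ := exists_norm_sub_le_of_isApproxSolution hK hu hR hM huc x₀ hε
    obtain ⟨N, hN⟩ := hsmall δ hδ
    exact ⟨N, fun k hk l hl => h _ _ _ _ _ _ (hN k hk) (hN l hl)⟩
  have hlim : ∀ t ∈ Icc 0 T, ∃ z, Tendsto (fun k => X k t) atTop (𝓝 z) := by
    intro t ht
    refine cauchySeq_tendsto_of_complete (Metric.cauchySeq_iff.2 fun ε hε => ?_)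
    obtain ⟨N, hN⟩ := hcau (ε / 2) (by positivity)
    exact ⟨N, fun k hk l hl => by
      rw [dist_eq_norm]
      linarith [hN k hk l hl t ht]⟩
  choose! x hx using hlim
  refine ⟨x, fun ε hε => ?_⟩
  obtain ⟨N, hN⟩ := hcau ε hε
  obtain ⟨N', hN'⟩ := hsmall ε hε
  refine ⟨X (max N N'), Y _, S _, hN' _ (le_max_right _ _), fun t ht => ?_⟩
  refine le_of_tendsto (tendsto_const_nhds.sub (hx t ht)).norm ?_
  filter_upwards [eventually_ge_atTop N] with l hl
  exact hN _ (le_max_left _ _) l hl t ht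

/-- A uniform limit of approximate solutions starts at `x₀` and is Lipschitz. -/
lemma lipschitz_of_limit {T R M : ℝ} {u : ℝ → E → E} (hM : 0 ≤ M) {x₀ : E} {x : ℝ → E}
    (hx : ∀ ε > 0, ∃ x' y τ, IsApproxSolution u T R M ε x₀ x' y τ ∧
      ∀ t ∈ Icc 0 T, ‖x' t - x t‖ ≤ ε) :
    LipschitzOnWith ⟨M, hM⟩ x (Icc 0 T) := by
  refine LipschitzOnWith.of_dist_le_mul fun a ha b hb => ?_
  rw [dist_eq_norm, Real.dist_eq]
  refine le_of_forall_pos_le_add fun ε hε => ?_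
  obtain ⟨x', y, τ, h, hε'⟩ := hx (ε / 2) (by positivity)
  have h1 := h.norm_sub_le hb ha
  have h2 : x a - x b = (x' a - x' b) - (x' a - x a) + (x' b - x b) := by abel
  rw [h2]
  refine (norm_add_le _ _).trans ?_
  have h3 := norm_sub_le (x' a - x' b) (x' a - x a)
  have h4 := hε' a ha
  have h5 := hε' b hb
  change _ ≤ M * _ + ε
  linarith

lemma init_of_limit {T R M : ℝ} {u : ℝ → E → E} (hT : 0 ≤ T) {x₀ : E} {x : ℝ → E}
    (hx : ∀ ε > 0, ∃ x' y τ, IsApproxSolution u T R M ε x₀ x' y τ ∧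
      ∀ t ∈ Icc 0 T, ‖x' t - x t‖ ≤ ε) : x 0 = x₀ := by
  rw [eq_comm, ← sub_eq_zero, ← norm_le_zero_iff]
  refine le_of_forall_pos_le_add fun ε hε => ?_
  obtain ⟨x', y, τ, h, hε'⟩ := hx ε hε
  simpa [h.init] using hε' 0 ⟨le_rfl, hT⟩

/-- If `G` is upper semicontinuous along `u` at `(t, x t)`, with closed convex values, then the
derivative of a limit of approximate solutions belongs to `G`. -/
theorem deriv_mem_of_limit [CompleteSpace E] {T R M t : ℝ} {u : ℝ → E → E} {x₀ : E} {x : ℝ → E}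
    (hx : ∀ ε > 0, ∃ x' y τ, IsApproxSolution u T R M ε x₀ x' y τ ∧
      ∀ t ∈ Icc 0 T, ‖x' t - x t‖ ≤ ε) (ht : t ∈ Ioo 0 T) {G : Set E} (hG : Convex ℝ G)
    (hGc : IsClosed G)
    (husc : ∀ ε > 0, ∃ δ > 0, ∀ s ∈ Icc 0 T, ∀ y, |s - t| ≤ δ → ‖y - x t‖ ≤ δ →
      u s y ∈ Metric.cthickening ε G) {x' : E} (hx' : HasDerivAt x x' t) : x' ∈ G := by
  rw [← hGc.closure_eq, Metric.closure_eq_iInter_cthickening, mem_iInter₂]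
  intro ε hε
  have hclosed : IsClosed (Metric.cthickening ε G) := Metric.isClosed_cthickening
  have hconv : Convex ℝ (Metric.cthickening ε G) := hG.cthickening ε
  obtain ⟨δ, hδ, hδu⟩ := husc ε hε
  have hcont := Metric.continuousAt_iff.1 hx'.continuousAt (δ / 3) (by positivity)
  obtain ⟨η, hη, hcont⟩ := hcont
  have hslope : Tendsto (slope x t) (𝓝[>] t) (𝓝 x') :=
    (hasDerivAt_iff_tendsto_slope.1 hx').mono_left (nhdsWithin_mono _ fun _ h => ne_of_gt h)
  refine hclosed.mem_of_tendsto hslope ?_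
  -- The budget is `δ / 2` for `b - t` plus `δ / 3` for the time lag, and three shares of `δ / 3`
  -- for the state.
  have hb : t < min T (t + min η (δ / 2)) := lt_min ht.2 (by linarith [lt_min hη (half_pos hδ)])
  filter_upwards [Ioo_mem_nhdsGT hb] with b hb
  have htb : t < b := hb.1
  have hbT : b < T := hb.2.trans_le (min_le_left _ _)
  have hb1 : b < t + min η (δ / 2) := hb.2.trans_le (min_le_right _ _)
  have hb2 := min_le_left η (δ / 2)
  have hb3 := min_le_right η (δ / 2)
  have htT : t ∈ Icc 0 T := Ioo_subset_Icc_self ht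
  have hbm : b ∈ Icc 0 T := ⟨ht.1.le.trans htb.le, hbT.le⟩
  -- the difference quotients of the approximations
  have hmem : ∀ γ > 0, γ ≤ δ / 3 → ∃ z ∈ Metric.cthickening ε G,
      ‖z - slope x t b‖ ≤ (b - t)⁻¹ * (2 * γ) := by
    intro γ hγ hγδ
    obtain ⟨X, Y, S, h, hXx⟩ := hx γ hγ
    refine ⟨slope X t b, ?_, ?_⟩
    · have hint := h.integral_eq t htT b hbm
      have hii : IntervalIntegrable (fun s => u (S s) (Y s)) volume t b :=
        h.intervalIntegrable.mono_set (by
          rw [uIcc_of_le htb.le, uIcc_of_le (ht.1.trans ht.2).le]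
          exact Icc_subset_Icc ht.1.le hbT.le)
      have := hconv.set_average_mem (μ := volume) (t := Ioc t b) hclosed
        (f := fun s => u (S s) (Y s)) (by simp [htb]) (by simp) ?_ hii.1
      · rw [← uIoc_of_le htb.le, interval_average_eq, hint] at this
        simpa [slope] using this
      · rw [ae_restrict_iff' measurableSet_Ioc]
        refine Eventually.of_forall fun s hs => ?_
        have hsT : s ∈ Icc 0 T := ⟨ht.1.le.trans hs.1.le, hs.2.trans hbT.le⟩
        refine hδu _ (h.time_mem s hsT) _ ?_ ?_
        · have h1 := abs_le.1 (h.time_close s hsT)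
          exact abs_le.2 ⟨by linarith [hs.1, hs.2], by linarith [hs.1, hs.2]⟩
        · have h1 := h.state_close s hsT
          have h2 := hXx s hsT
          have h3 : ‖x s - x t‖ < δ / 3 := by
            rw [← dist_eq_norm]
            refine hcont ?_
            rw [Real.dist_eq, abs_of_pos (sub_pos.2 hs.1)]
            linarith [hs.2]
          have h4 : Y s - x t = (X s - x s) - (X s - Y s) + (x s - x t) := by abel
          rw [h4]
          refine (norm_add_le _ _).trans ?_
          linarith [norm_sub_le (X s - x s) (X s - Y s)]
    · have h1 : slope X t b - slope x t b = (b - t)⁻¹ • ((X b - x b) - (X t - x t)) := by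
        simp only [slope, vsub_eq_sub, ← smul_sub]
        congr 1
        abel
      rw [h1, norm_smul, norm_inv, Real.norm_of_nonneg (sub_nonneg.2 htb.le)]
      have h2 := norm_sub_le (X b - x b) (X t - x t)
      have h3 := hXx b hbm
      have h4 := hXx t htT
      have h5 : 0 < b - t := sub_pos.2 htb
      gcongr
      linarith
  rw [← hclosed.closure_eq, Metric.mem_closure_iff]
  intro r hr
  have hbt : 0 < b - t := sub_pos.2 htb
  obtain ⟨z, hz, hzr⟩ := hmem (min (δ / 3) ((b - t) * r / 3)) (by positivity) (min_le_left _ _)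
  refine ⟨z, hz, ?_⟩
  rw [dist_comm, dist_eq_norm]
  refine hzr.trans_lt ?_
  rw [inv_mul_lt_iff₀ hbt]
  have := min_le_right (δ / 3) ((b - t) * r / 3)
  have : 0 < (b - t) * r := by positivity
  linarith

end Limit

/-! ### A Grönwall argument for absolutely continuous curves. -/

section Uniqueness

variable {E : Type*} [NormedAddCommGroup E] [InnerProductSpace ℝ E]

lemma AbsolutelyContinuousOnInterval.norm {F : Type*} [SeminormedAddCommGroup F] {d : ℝ → F}
    {a b : ℝ}
    (hd : AbsolutelyContinuousOnInterval d a b) :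
    AbsolutelyContinuousOnInterval (fun t => ‖d t‖) a b := by
  refine squeeze_zero (fun t ↦ ?_) (fun t ↦ ?_) hd
  · exact Finset.sum_nonneg fun i hi ↦ dist_nonneg
  · exact Finset.sum_le_sum fun i _ => (dist_norm_norm_le _ _).trans (dist_eq_norm _ _).ge

/-- Grönwall's lemma for the difference `d` of two absolutely continuous curves. -/
lemma eq_zero_of_ae_inner_deriv_le {d : ℝ → E} {T C : ℝ} (hd : AbsolutelyContinuousOnInterval d 0 T)
    (h0 : d 0 = 0)
    (hderiv : ∀ᵐ t ∂(volume.restrict (Ioo 0 T)), ∃ d', HasDerivAt d d' t ∧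
      inner ℝ d' (d t) ≤ C * ‖d t‖ ^ 2) : ∀ t ∈ Icc 0 T, d t = 0 := by
  intro t ht
  have hsub : uIcc 0 t ⊆ uIcc 0 T := by
    rw [uIcc_of_le ht.1, uIcc_of_le (ht.1.trans ht.2)]
    exact Icc_subset_Icc_right ht.2
  have hexp : AbsolutelyContinuousOnInterval (fun s : ℝ => Real.exp (-(2 * C) * s)) 0 t := by
    refine ContDiffOn.absolutelyContinuousOnInterval (ContDiff.contDiffOn ?_)
    fun_prop
  -- With the integrating factor, the squared norm has an a.e. nonpositive derivative; absolute
  -- continuity lets this be integrated.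
  have hφ : AbsolutelyContinuousOnInterval
      (fun s => Real.exp (-(2 * C) * s) * (‖d s‖ * ‖d s‖)) 0 t :=
    hexp.fun_mul ((hd.mono hsub).norm.fun_mul (hd.mono hsub).norm)
  have hint := hφ.integral_deriv_eq_sub
  have hle : ∫ s in (0 : ℝ)..t, deriv (fun s => Real.exp (-(2 * C) * s) * (‖d s‖ * ‖d s‖)) s ≤ 0 := by
    rw [intervalIntegral.integral_of_le ht.1, integral_Ioc_eq_integral_Ioo]
    refine integral_nonpos_of_ae ?_
    filter_upwards [ae_restrict_of_ae_restrict_of_subset (Ioo_subset_Ioo_right ht.2) hderiv]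
      with s ⟨d', hd', hle⟩
    have h1 : HasDerivAt (fun s : ℝ => Real.exp (-(2 * C) * s))
        (Real.exp (-(2 * C) * s) * (-(2 * C))) s := by
      simpa using ((hasDerivAt_id s).const_mul (-(2 * C))).exp
    have h2 := h1.mul hd'.norm_sq
    have h3 : (fun s => Real.exp (-(2 * C) * s) * (‖d s‖ * ‖d s‖)) =
        (fun s : ℝ => Real.exp (-(2 * C) * s)) * (fun s => ‖d s‖ ^ 2) := by
      ext s
      simp [sq]
    rw [h3, h2.deriv, real_inner_comm]
    have := Real.exp_pos (-(2 * C) * s)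
    have h4 : Real.exp (-(2 * C) * s) * (inner ℝ d' (d s) - C * ‖d s‖ ^ 2) ≤ 0 :=
      mul_nonpos_of_nonneg_of_nonpos this.le (by linarith)
    change _ ≤ (0 : ℝ)
    linarith
  rw [hint, h0] at hle
  have h5 := Real.exp_pos (-(2 * C) * t)
  have h6 : ‖d t‖ * ‖d t‖ ≤ 0 := by
    by_contra h
    push Not at h
    have := mul_pos h5 h
    simp only [norm_zero, mul_zero, sub_zero] at hle
    linarith
  exact norm_eq_zero.1 (mul_self_eq_zero.1 (le_antisymm h6 (mul_self_nonneg _)))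

end Uniqueness

/-! ### Convexity, compactness and upper semicontinuity of the multivalued sign. -/

section Sign

open Filter Topology

lemma sgn_of_pos {y : ℝ} (hy : 0 < y) : sgn y = {1} := by
  ext s
  simp [sgn, hy, hy.not_gt, hy.ne']

lemma sgn_of_neg {y : ℝ} (hy : y < 0) : sgn y = {-1} := by
  ext s
  simp [sgn, hy, hy.not_gt, hy.ne]

lemma sgn_zero : sgn 0 = Icc (-1) 1 := by
  ext s
  simp [sgn]

lemma sgn_subset (y : ℝ) : sgn y ⊆ Icc (-1) 1 := by
  rcases lt_trichotomy y 0 with hy | rfl | hy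
  · simp [sgn_of_neg hy]
  · rw [sgn_zero]
  · simp [sgn_of_pos hy]

lemma convex_sgn (y : ℝ) : Convex ℝ (sgn y) := by
  rcases lt_trichotomy y 0 with hy | rfl | hy
  · simp [sgn_of_neg hy]
  · simpa [sgn_zero] using convex_Icc _ _
  · simp [sgn_of_pos hy]

lemma isCompact_sgn (y : ℝ) : IsCompact (sgn y) := by
  rcases lt_trichotomy y 0 with hy | rfl | hy
  · simp [sgn_of_neg hy]
  · simpa [sgn_zero] using isCompact_Icc
  · simp [sgn_of_pos hy]

lemma sign_mem_sgn (y : ℝ) : Real.sign y ∈ sgn y := by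
  rcases lt_trichotomy y 0 with hy | rfl | hy
  · simp [sgn_of_neg hy, Real.sign_of_neg hy]
  · simp [sgn_zero]
  · simp [sgn_of_pos hy, Real.sign_of_pos hy]

/-- The multivalued sign is upper semicontinuous. -/
lemma eventually_sgn_subset (y : ℝ) : ∀ᶠ z in 𝓝 y, sgn z ⊆ sgn y := by
  rcases lt_trichotomy y 0 with hy | rfl | hy
  · filter_upwards [eventually_lt_nhds hy] with z hz
    rw [sgn_of_neg hz, sgn_of_neg hy]
  · exact Eventually.of_forall fun z => (sgn_subset z).trans sgn_zero.ge
  · filter_upwards [eventually_gt_nhds hy] with z hz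
    rw [sgn_of_pos hz, sgn_of_pos hy]

variable {m : ℕ}

lemma Sgn_eq_pi (y : Fin m → ℝ) : Sgn y = univ.pi fun i => sgn (y i) := by
  ext s
  simp [Sgn]

lemma convex_Sgn (y : Fin m → ℝ) : Convex ℝ (Sgn y) := by
  rw [Sgn_eq_pi]
  exact convex_pi fun i _ => convex_sgn _

lemma isCompact_Sgn (y : Fin m → ℝ) : IsCompact (Sgn y) := by
  rw [Sgn_eq_pi]
  exact isCompact_univ_pi fun i => isCompact_sgn _

end Sign

/-! ### The sliding right-hand side and its selection satisfy the abstract hypotheses. -/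

section Sliding

open Filter Topology

variable {n m : ℕ}

lemma toLp_mulVec (G : Matrix (Fin n) (Fin m) ℝ) (s : Fin m → ℝ) :
    WithLp.toLp 2 (G *ᵥ s) = ∑ i, s i • colVec G i := by
  ext j
  simp [Matrix.mulVec, dotProduct, colVec, mul_comm]

lemma continuous_colVec {g : EuclideanSpace ℝ (Fin n) → Matrix (Fin n) (Fin m) ℝ}
    (hg : ∀ j i, Continuous (fun x => g x j i)) (i : Fin m) :
    Continuous (fun x => colVec (g x) i) :=
  (PiLp.continuous_toLp 2 _).comp (continuous_pi fun j => hg j i)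

lemma norm_toLp_mulVec_sub_le (G G' : Matrix (Fin n) (Fin m) ℝ) {s : Fin m → ℝ}
    (hs : ∀ i, s i ∈ Icc (-1 : ℝ) 1) :
    ‖(WithLp.toLp 2 (G *ᵥ s) - WithLp.toLp 2 (G' *ᵥ s) : EuclideanSpace ℝ (Fin n))‖ ≤
      ∑ i, ‖colVec G i - colVec G' i‖ := by
  rw [toLp_mulVec, toLp_mulVec, ← Finset.sum_sub_distrib]
  refine (norm_sum_le _ _).trans (Finset.sum_le_sum fun i _ => ?_)
  rw [← smul_sub, norm_smul]
  exact mul_le_of_le_one_left (norm_nonneg _) (abs_le.2 (hs i))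

lemma norm_toLp_mulVec_le (G : Matrix (Fin n) (Fin m) ℝ) {s : Fin m → ℝ}
    (hs : ∀ i, s i ∈ Icc (-1 : ℝ) 1) :
    ‖(WithLp.toLp 2 (G *ᵥ s) : EuclideanSpace ℝ (Fin n))‖ ≤ ∑ i, ‖colVec G i‖ := by
  rw [toLp_mulVec]
  refine (norm_sum_le _ _).trans (Finset.sum_le_sum fun i _ => ?_)
  rw [norm_smul]
  exact mul_le_of_le_one_left (norm_nonneg _) (abs_le.2 (hs i))

variable {T : ℝ} {f : ℝ → EuclideanSpace ℝ (Fin n) → EuclideanSpace ℝ (Fin n)}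
  {g : EuclideanSpace ℝ (Fin n) → Matrix (Fin n) (Fin m) ℝ}
  {h : EuclideanSpace ℝ (Fin n) → Fin m → ℝ}

lemma convex_slidingRHS (t : ℝ) (x : EuclideanSpace ℝ (Fin n)) :
    Convex ℝ (slidingRHS f g h t x) := by
  rintro _ ⟨s, hs, rfl⟩ _ ⟨s', hs', rfl⟩ a b ha hb hab
  refine ⟨a • s + b • s', convex_Sgn _ hs hs' ha hb hab, ?_⟩
  rw [Matrix.mulVec_add, Matrix.mulVec_smul, Matrix.mulVec_smul, WithLp.toLp_add,
    WithLp.toLp_smul, WithLp.toLp_smul, smul_sub, smul_sub, sub_add_sub_comm, ← add_smul, hab,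
    one_smul]

lemma isClosed_slidingRHS (t : ℝ) (x : EuclideanSpace ℝ (Fin n)) :
    IsClosed (slidingRHS f g h t x) := by
  have : slidingRHS f g h t x =
      (fun s => f t x - WithLp.toLp 2 (g x *ᵥ s)) '' Sgn (h x) := by
    ext z
    simp [slidingRHS, eq_comm]
  rw [this]
  refine ((isCompact_Sgn _).image ?_).isClosed
  exact continuous_const.sub ((PiLp.continuous_toLp 2 _).comp (by fun_prop))

/-- `f(t,·) - g Sgn(h)` is one-sided Lipschitz, uniformly in `t`. -/
lemma exists_inner_slidingRHS_le (hf : LipschitzInState T f)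
    (hyp : ∀ i, IsHypomonotone (columnSign g h i)) :
    ∃ K : ℝ, 0 ≤ K ∧ ∀ t ∈ Icc 0 T, ∀ x y, ∀ z ∈ slidingRHS f g h t x,
      ∀ z' ∈ slidingRHS f g h t y, inner ℝ (z - z') (x - y) ≤ K * ‖x - y‖ ^ 2 := by
  obtain ⟨L, hL, hf⟩ := hf
  choose k hk hmono using hyp
  refine ⟨L + ∑ i, k i, add_nonneg hL (Finset.sum_nonneg fun i _ => hk i), ?_⟩
  rintro t ht x y _ ⟨s, hs, rfl⟩ _ ⟨s', hs', rfl⟩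
  have h1 : inner ℝ (f t x - f t y) (x - y) ≤ L * ‖x - y‖ ^ 2 := by
    refine (real_inner_le_norm _ _).trans ?_
    rw [sq, ← mul_assoc]
    exact mul_le_mul_of_nonneg_right (hf t ht x y) (norm_nonneg _)
  have h2 : ∀ i, -(k i * ‖x - y‖ ^ 2) ≤
      inner ℝ (s i • colVec (g x) i - s' i • colVec (g y) i) (x - y) := by
    intro i
    have := hmono i x y _ ⟨_, ⟨s i, hs i, rfl⟩, rfl⟩ _ ⟨_, ⟨s' i, hs' i, rfl⟩, rfl⟩
    rw [add_sub_add_comm, ← smul_sub, inner_add_left, real_inner_smul_left,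
      real_inner_self_eq_norm_sq] at this
    linarith
  have h3 := Finset.sum_le_sum fun i (_ : i ∈ Finset.univ) => h2 i
  rw [← sum_inner, Finset.sum_sub_distrib, ← toLp_mulVec, ← toLp_mulVec, Finset.sum_neg_distrib,
    ← Finset.sum_mul] at h3
  rw [sub_sub_sub_comm, inner_sub_left]
  linarith

/-- A selection of `f(t,x) - g(x) Sgn(h(x))`. -/
noncomputable def slidingSelection (f : ℝ → EuclideanSpace ℝ (Fin n) → EuclideanSpace ℝ (Fin n))
    (g : EuclideanSpace ℝ (Fin n) → Matrix (Fin n) (Fin m) ℝ)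
    (h : EuclideanSpace ℝ (Fin n) → Fin m → ℝ) (t : ℝ) (x : EuclideanSpace ℝ (Fin n)) :
    EuclideanSpace ℝ (Fin n) :=
  f t x - WithLp.toLp 2 (g x *ᵥ fun i => Real.sign (h x i))

lemma slidingSelection_mem (t : ℝ) (x : EuclideanSpace ℝ (Fin n)) :
    slidingSelection f g h t x ∈ slidingRHS f g h t x :=
  ⟨_, fun _ => sign_mem_sgn _, rfl⟩

lemma continuousOn_uncurry (hf : LipschitzInState T f)
    (hft : ∀ x, ContinuousOn (fun t => f t x) (Icc 0 T)) :
    ContinuousOn (fun p : ℝ × EuclideanSpace ℝ (Fin n) => f p.1 p.2) (Icc 0 T ×ˢ univ) := by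
  obtain ⟨L, hL, hf⟩ := hf
  refine continuousOn_prod_of_continuousOn_lipschitzOnWith' _ ⟨L, hL⟩ (fun t ht => ?_)
    (fun x _ => hft x)
  refine LipschitzOnWith.of_dist_le_mul fun x _ y _ => ?_
  rw [dist_eq_norm, dist_eq_norm]
  exact hf t ht x y

lemma exists_norm_slidingSelection_le (hg : ∀ j i, Continuous (fun x => g x j i))
    (hf : ContinuousOn (fun p : ℝ × EuclideanSpace ℝ (Fin n) => f p.1 p.2) (Icc 0 T ×ˢ univ))
    (R : ℝ) : ∃ M, ∀ t ∈ Icc 0 T, ∀ x, ‖x‖ ≤ R → ‖slidingSelection f g h t x‖ ≤ M := by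
  obtain ⟨A, hA⟩ := ((isCompact_Icc (a := (0 : ℝ)) (b := T)).prod
    (isCompact_closedBall (0 : EuclideanSpace ℝ (Fin n)) R)).exists_bound_of_continuousOn
    (hf.mono (prod_mono le_rfl (subset_univ _)))
  obtain ⟨B, hB⟩ := (isCompact_closedBall (0 : EuclideanSpace ℝ (Fin n)) R).exists_bound_of_continuousOn
    (f := fun x => ∑ i, ‖colVec (g x) i‖)
    (continuous_finsetSum _ fun i _ => (continuous_colVec hg i).norm).continuousOn
  refine ⟨A + B, fun t ht x hx => ?_⟩
  have hx' : x ∈ Metric.closedBall (0 : EuclideanSpace ℝ (Fin n)) R := by simpa using hx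
  refine (norm_sub_le _ _).trans (add_le_add (hA (t, x) ⟨ht, hx'⟩) ?_)
  exact ((norm_toLp_mulVec_le _ fun i => sgn_subset _ (sign_mem_sgn _)).trans (le_abs_self _)).trans
    (hB x hx')

/-- The sign term does not depend on time and cancels, so uniform continuity of `f` on a compact set
suffices despite the jumps in `x`. -/
lemma exists_norm_slidingSelection_sub_le
    (hf : ContinuousOn (fun p : ℝ × EuclideanSpace ℝ (Fin n) => f p.1 p.2) (Icc 0 T ×ˢ univ))
    (R : ℝ) {ε : ℝ} (hε : 0 < ε) : ∃ δ > 0, ∀ s ∈ Icc 0 T, ∀ t ∈ Icc 0 T, |s - t| ≤ δ →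
      ∀ x, ‖x‖ ≤ R → ‖slidingSelection f g h s x - slidingSelection f g h t x‖ ≤ ε := by
  have huc := ((isCompact_Icc (a := (0 : ℝ)) (b := T)).prod
    (isCompact_closedBall (0 : EuclideanSpace ℝ (Fin n)) R)).uniformContinuousOn_of_continuous
    (hf.mono (prod_mono le_rfl (subset_univ _)))
  obtain ⟨δ, hδ, huc⟩ := Metric.uniformContinuousOn_iff.1 huc ε hε
  refine ⟨δ / 2, by positivity, fun s hs t ht hst x hx => ?_⟩
  have hx' : x ∈ Metric.closedBall (0 : EuclideanSpace ℝ (Fin n)) R := by simpa using hx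
  have := huc (s, x) ⟨hs, hx'⟩ (t, x) ⟨ht, hx'⟩ (by
    rw [Prod.dist_eq, dist_self, Real.dist_eq, max_lt_iff]
    exact ⟨by linarith, hδ⟩)
  rw [dist_eq_norm] at this
  simpa [slidingSelection] using this.le

/-- The selection is upper semicontinuous with respect to the multivalued right-hand side. -/
lemma slidingSelection_mem_cthickening (hg : ∀ j i, Continuous (fun x => g x j i))
    (hh : Continuous h)
    (hf : ContinuousOn (fun p : ℝ × EuclideanSpace ℝ (Fin n) => f p.1 p.2) (Icc 0 T ×ˢ univ))
    {t : ℝ} (ht : t ∈ Icc 0 T) (x : EuclideanSpace ℝ (Fin n)) {ε : ℝ} (hε : 0 < ε) :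
    ∃ δ > 0, ∀ s ∈ Icc 0 T, ∀ y, |s - t| ≤ δ → ‖y - x‖ ≤ δ →
      slidingSelection f g h s y ∈ Metric.cthickening ε (slidingRHS f g h t x) := by
  obtain ⟨δ₁, hδ₁, h1⟩ := Metric.continuousOn_iff.1 hf (t, x) ⟨ht, mem_univ _⟩ (ε / 2)
    (by positivity)
  have h2 : ∀ᶠ y in 𝓝 x, ∑ i, ‖colVec (g y) i - colVec (g x) i‖ < ε / 2 := by
    refine ContinuousAt.eventually_lt (Continuous.continuousAt ?_) continuousAt_const
      (by simpa using hε)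
    exact continuous_finsetSum _ fun i _ => ((continuous_colVec hg i).sub continuous_const).norm
  have h3 : ∀ᶠ y in 𝓝 x, ∀ i, sgn (h y i) ⊆ sgn (h x i) :=
    eventually_all.2 fun i => (((continuous_apply i).comp hh).tendsto x).eventually
      (eventually_sgn_subset (h x i))
  obtain ⟨δ₂, hδ₂, h4⟩ := Metric.eventually_nhds_iff.1 (h2.and h3)
  refine ⟨min δ₁ δ₂ / 2, by positivity, fun s hs y hst hyx => ?_⟩
  have hmin : 0 < min δ₁ δ₂ := by positivity
  have hy₂ : dist y x < δ₂ := by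
    rw [dist_eq_norm]
    linarith [min_le_right δ₁ δ₂]
  have hy₁ : dist (s, y) (t, x) < δ₁ := by
    rw [Prod.dist_eq, dist_eq_norm, dist_eq_norm, Real.norm_eq_abs, max_lt_iff]
    constructor <;> linarith [min_le_left δ₁ δ₂]
  have h5 := h1 (s, y) ⟨hs, mem_univ _⟩ hy₁
  obtain ⟨h6, h7⟩ := h4 hy₂
  -- The nearby point keeps the signs of `h y` while `f` and `g` are moved to `(t, x)`; upper
  -- semicontinuity makes these signs admissible at `x`.
  refine Metric.mem_cthickening_of_dist_le _
    (f t x - WithLp.toLp 2 (g x *ᵥ fun i => Real.sign (h y i))) _ _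
    ⟨_, fun i => h7 i (sign_mem_sgn _), rfl⟩ ?_
  rw [dist_eq_norm] at h5 ⊢
  rw [slidingSelection, sub_sub_sub_comm]
  refine (norm_sub_le _ _).trans ?_
  have := norm_toLp_mulVec_sub_le (g y) (g x) (s := fun i => Real.sign (h y i))
    fun i => sgn_subset _ (sign_mem_sgn _)
  linarith

/-- The one-sided bound holds for all elements of the two values, so it applies whatever elements
the two derivatives select. -/
theorem IsSolution.eqOn (hf : LipschitzInState T f) (hyp : ∀ i, IsHypomonotone (columnSign g h i))
    {x₀ : EuclideanSpace ℝ (Fin n)} {x y : ℝ → EuclideanSpace ℝ (Fin n)}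
    (hx : IsSolution T f g h x₀ x) (hy : IsSolution T f g h x₀ y) : EqOn x y (Icc 0 T) := by
  obtain ⟨K, -, hK⟩ := exists_inner_slidingRHS_le hf hyp
  intro t ht
  refine sub_eq_zero.1 (eq_zero_of_ae_inner_deriv_le (d := fun t => x t - y t) (C := K)
    (hx.1.fun_sub hy.1) (by rw [hx.2.1, hy.2.1, sub_self]) ?_ t ht)
  filter_upwards [hx.2.2, hy.2.2, ae_restrict_mem measurableSet_Ioo]
    with s ⟨x', hx', hdx⟩ ⟨y', hy', hdy⟩ hs
  exact ⟨x' - y', hdx.sub hdy, hK s (Ioo_subset_Icc_self hs) _ _ _ hx' _ hy'⟩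

end Sliding

theorem mainTheorem8 (n m : ℕ) (T : ℝ) (hT : 0 < T)
    (f : ℝ → EuclideanSpace ℝ (Fin n) → EuclideanSpace ℝ (Fin n))
    (g : EuclideanSpace ℝ (Fin n) → Matrix (Fin n) (Fin m) ℝ)
    (h : EuclideanSpace ℝ (Fin n) → Fin m → ℝ)
    (hg : ∀ j i, ContDiff ℝ ∞ (fun x => g x j i))
    (hh : ContDiff ℝ ∞ h)
    (hf_lip : LipschitzInState T f)
    (hf_time : TimeDerivBoundedL2 T f)
    (hyp : ∀ i, IsHypomonotone (columnSign g h i))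
    (x₀ : EuclideanSpace ℝ (Fin n)) :
    ∃ x : ℝ → EuclideanSpace ℝ (Fin n),
      IsSolution T f g h x₀ x ∧ (∃ K : ℝ≥0, LipschitzOnWith K x (Icc 0 T)) ∧
        ∀ y : ℝ → EuclideanSpace ℝ (Fin n), IsSolution T f g h x₀ y → EqOn y x (Icc 0 T) := by
  obtain ⟨K, hK0, hK⟩ := exists_inner_slidingRHS_le hf_lip hyp
  have hg' : ∀ j i, Continuous (fun x => g x j i) := fun j i => (hg j i).continuous
  have hfc := continuousOn_uncurry hf_lip fun x => by
    simpa only [uIcc_of_le hT.le] using (hf_time.1 x).continuousOn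
  have hu : OneSidedLipschitz T K (slidingSelection f g h) := fun t ht x y =>
    hK t ht x y _ (slidingSelection_mem t x) _ (slidingSelection_mem t y)
  obtain ⟨R, M, hR, hM, hex⟩ := exists_isApproxSolution hT hK0 hu
    (exists_norm_slidingSelection_le hg' hfc) x₀
  obtain ⟨x, hx⟩ := exists_limit_of_isApproxSolution hK0 hu hR hM
    (fun ρ hρ => exists_norm_slidingSelection_sub_le hfc R hρ) x₀ hex
  have hlip := lipschitz_of_limit hM hx
  have hsol : IsSolution T f g h x₀ x := by
    refine ⟨LipschitzOnWith.absolutelyContinuousOnInterval (by rwa [uIcc_of_le hT.le]),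
      init_of_limit hT.le hx, ?_⟩
    -- By Rademacher the Lipschitz limit is differentiable a.e., and the inclusion then holds at
    -- every interior point of differentiability.
    filter_upwards [ae_restrict_of_ae_restrict_of_subset Ioo_subset_Icc_self
      (hlip.ae_differentiableWithinAt measurableSet_Icc), ae_restrict_mem measurableSet_Ioo]
      with t hdiff ht
    have hd := (hdiff.differentiableAt (Icc_mem_nhds ht.1 ht.2)).hasDerivAt
    exact ⟨_, deriv_mem_of_limit hx ht (convex_slidingRHS t _) (isClosed_slidingRHS t _)
      (fun ε hε => slidingSelection_mem_cthickening hg' hh.continuous hfc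
        (Ioo_subset_Icc_self ht) _ hε) hd, hd⟩
  exact ⟨x, hsol, ⟨_, hlip⟩, fun y hy => hy.eqOn hf_lip hyp hsol⟩
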